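/- A finite word $w$ is a finite sequence of letters; $|w|$ denotes its length, and a factor of $w$ is a contiguous subword of $w$. The word $w$ is rich if it has exactly $|w|+1$ distinct palindromic factors, including the empty word. It is square-free if it has no factor of the form $uu$ with $u$ a non-empty word. For a positive integer $n$ let $r(n)$ denote the length of a longest rich square-free word over an alphabet with $n$ letters. Then for every integer $n\ge 5$ this maximum exists and $$2.008^{\,n} < r(n) < 2.237^{\,n}.$$ -/

import Mathlib

/-- The set `Pal(w)` of palindromic factors of a finite word `w`, the empty word included: the
contiguous subwords of `w` that are equal to their reversal. -/
def palFactors {α : Type*} (w : List α) : Set (List α) :=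
  {p | p <:+: w ∧ p = p.reverse}

/-- A finite word `w` is rich if it has exactly `|w| + 1` distinct palindromic factors,
including the empty word. -/
def IsRichWord {α : Type*} (w : List α) : Prop :=
  (palFactors w).ncard = w.length + 1

/-- A finite word is square-free if it has no factor `uu` with `u` a non-empty word. -/
def IsSquareFreeWord {α : Type*} (w : List α) : Prop :=
  ∀ u : List α, u ≠ [] → ¬ (u ++ u <:+: w)

/-- The set of lengths of the rich square-free words over an alphabet with `n` letters. -/
def richSquareFreeLengths (n : ℕ) : Set ℕ :=
  {l | ∃ w : List (Fin n), IsRichWord w ∧ IsSquareFreeWord w ∧ w.length = l}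

/-- `r(n)`, the length of a longest rich square-free word over an alphabet with `n` letters
(the supremum in `ℕ` is `0` by convention if the lengths are unbounded). -/
noncomputable def maxRichSquareFreeLength (n : ℕ) : ℕ :=
  sSup (richSquareFreeLengths n)

/-!
The word `w~` is the reversal of `w`.

**Upper bound.** In a rich word every complete return to a letter is a palindrome
(`IsRichWord.reverse_eq_of_return`), because the letter that completes it has to create a new
palindrome. The upper bound uses only this and square-freeness (`IsReturnWord`), two properties
inherited by factors. The claim is that such a word over `n` letters satisfies
`|w| + 1 ≤ 2.237 ^ n` (`lengthBoundUpTo`), by induction on `n`.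

The structural fact is `IsReturnWord.exists_split`: if `x` is the last letter to appear in `w` and
occurs at least twice, then `w = u' z s x s~ z s x v`, where `z` does not occur in `s` or in `v`.
So `w` is `u' z s`, the reversal of `s~ z u'~`, followed by `x s~ z` and by `s x v`, where `s` has
at most `n - 2` letters. The words `s~ z u` of this form can be split in the same way, and the
inequalities of `ConfigBound` between `|s|`, `|u|` and the length of the longest common prefix of
`s` and `u` go through by induction (`IsReturnWord.configBound`). The common prefixes matter since
square-freeness keeps the two of them, at the two ends of `s`, from covering `s`
(`IsSquareFreeWord.lcpLen_add_lcpLen_lt`).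
What remains is linear programming (`ConfigBound.combine`, `ConfigBound.total_le`).

**Lower bound.** If `v` and `w = w₁ w₂ ⋯` are rich and square-free over disjoint alphabets, then so
is `v w₁ v~ w₂ v w₃ ⋯` (`insertWord`), so the numbers `r(n) + 1` are supermultiplicative
(`exists_mem_richSquareFreeLengths_add`). A rich square-free word of length 33 over five letters
and the word of length 1 over one letter give the bound, as `34 > 2.008 ^ 5`.
-/

/-! ### Factors, palindromes and rich words -/

theorem IsSquareFreeWord.infix {α : Type*} {v w : List α} (hw : IsSquareFreeWord w)
    (h : v <:+: w) : IsSquareFreeWord v :=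
  fun u hu huv => hw u hu (huv.trans h)

theorem IsSquareFreeWord.reverse {α : Type*} {w : List α} (hw : IsSquareFreeWord w) :
    IsSquareFreeWord w.reverse := by
  intro u hu h
  refine hw u.reverse (by simpa using hu) ?_
  rw [← List.reverse_infix]
  simpa using h

theorem palFactors_finite {α : Type*} (w : List α) : (palFactors w).Finite := by
  refine (List.finite_toSet w.sublists).subset ?_
  rintro p ⟨hp, -⟩
  exact List.mem_sublists.2 hp.sublist

theorem nil_mem_palFactors {α : Type*} (w : List α) : [] ∈ palFactors w :=
  ⟨List.nil_infix, rfl⟩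

theorem palFactors_nil {α : Type*} : palFactors ([] : List α) = {[]} := by
  ext p
  simp only [palFactors, Set.mem_ofPred_eq, Set.mem_singleton_iff, List.infix_nil]
  exact ⟨fun h => h.1, fun h => ⟨h, by simp [h]⟩⟩

theorem palFactors_reverse {α : Type*} (w : List α) : palFactors w.reverse = palFactors w := by
  ext p
  simp only [palFactors, Set.mem_ofPred_eq]
  refine and_congr_left fun hp => ?_
  rw [← List.reverse_infix, List.reverse_reverse, ← hp]

theorem palFactors_subset_cons {α : Type*} (x : α) (w : List α) :
    palFactors w ⊆ palFactors (x :: w) :=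
  fun _ hp => ⟨hp.1.trans (List.suffix_cons x w).isInfix, hp.2⟩

/-- A new palindromic factor of `x :: w` is a prefix of it, and of two palindromic prefixes the
shorter one is also a suffix of the longer one, hence occurs in `w`. -/
theorem palFactors_cons_sdiff_subsingleton {α : Type*} (x : α) (w : List α) :
    (palFactors (x :: w) \ palFactors w).Subsingleton := by
  have key : ∀ p q : List α, p ∈ palFactors (x :: w) \ palFactors w →
      q ∈ palFactors (x :: w) \ palFactors w → p <+: q → p = q := by
    rintro p q ⟨⟨hp, hpp⟩, hp'⟩ ⟨⟨hq, hqp⟩, hq'⟩ hpq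
    by_contra hne
    have hq1 : q <+: x :: w := by
      rcases List.infix_cons_iff.1 hq with h | h
      · exact h
      · exact absurd ⟨h, hqp⟩ hq'
    have hsuf : p <:+ q := by
      rw [← List.reverse_prefix, ← hpp, ← hqp]
      exact hpq
    obtain ⟨t, ht⟩ := hsuf
    cases t with
    | nil => exact hne (by simpa using ht)
    | cons c t =>
      subst ht
      have h1 : t ++ p <+: w := (List.cons_prefix_cons.1 hq1).2
      exact hp' ⟨(List.suffix_append t p).isInfix.trans h1.isInfix, hpp⟩
  have hpre : ∀ p, p ∈ palFactors (x :: w) \ palFactors w → p <+: x :: w := by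
    rintro p ⟨⟨hp, hpp⟩, hp'⟩
    rcases List.infix_cons_iff.1 hp with h | h
    · exact h
    · exact absurd ⟨h, hpp⟩ hp'
  intro p hp q hq
  rcases List.prefix_or_prefix_of_prefix (hpre p hp) (hpre q hq) with h | h
  · exact key p q hp hq h
  · exact (key q p hq hp h).symm

theorem ncard_palFactors_cons_le {α : Type*} (x : α) (w : List α) :
    (palFactors (x :: w)).ncard ≤ (palFactors w).ncard + 1 := by
  rw [← Set.ncard_sdiff_add_ncard_of_subset (palFactors_subset_cons x w) (palFactors_finite _)]
  have := (Set.ncard_le_one ((palFactors_finite (x :: w)).sdiff (t := palFactors w))).2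
    fun p hp q hq => palFactors_cons_sdiff_subsingleton x w hp hq
  omega

theorem ncard_palFactors_le {α : Type*} (w : List α) :
    (palFactors w).ncard ≤ w.length + 1 := by
  induction w with
  | nil => simp [palFactors_nil]
  | cons x w ih =>
    have := ncard_palFactors_cons_le x w
    simp only [List.length_cons]
    omega

theorem IsRichWord.of_le {α : Type*} {w : List α} (h : w.length + 1 ≤ (palFactors w).ncard) :
    IsRichWord w :=
  le_antisymm (ncard_palFactors_le w) h

theorem IsRichWord.of_cons {α : Type*} {x : α} {w : List α} (h : IsRichWord (x :: w)) :
    IsRichWord w := by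
  have h1 := ncard_palFactors_cons_le x w
  rw [IsRichWord, List.length_cons] at h
  exact IsRichWord.of_le (by omega)

theorem IsRichWord.reverse {α : Type*} {w : List α} (h : IsRichWord w) :
    IsRichWord w.reverse := by
  rw [IsRichWord, palFactors_reverse, List.length_reverse]
  exact h

theorem IsRichWord.suffix {α : Type*} {v w : List α} (h : IsRichWord w) (hv : v <:+ w) :
    IsRichWord v := by
  obtain ⟨t, rfl⟩ := hv
  induction t with
  | nil => exact h
  | cons x t ih => exact ih h.of_cons

theorem IsRichWord.infix {α : Type*} {v w : List α} (h : IsRichWord w) (hv : v <:+: w) :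
    IsRichWord v := by
  obtain ⟨s, t, rfl⟩ := hv
  rw [List.append_assoc] at h
  have h1 := (h.suffix (List.suffix_append s _)).reverse
  rw [List.reverse_append] at h1
  simpa using (h1.suffix (List.suffix_append _ _)).reverse

theorem IsRichWord.exists_new_palindrome {α : Type*} {x : α} {w : List α}
    (h : IsRichWord (x :: w)) : ∃ p, p <+: x :: w ∧ p = p.reverse ∧ ¬ p <:+: w := by
  have hne : ¬ palFactors (x :: w) ⊆ palFactors w := by
    intro hs
    have h1 := Set.ncard_le_ncard hs (palFactors_finite w)
    have h2 := ncard_palFactors_le w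
    rw [IsRichWord, List.length_cons] at h
    omega
  obtain ⟨p, ⟨hp, hpp⟩, hp'⟩ := Set.not_subset.1 hne
  rcases List.infix_cons_iff.1 hp with h | h
  · exact ⟨p, h, hpp, fun hn => hp' ⟨hn, hpp⟩⟩
  · exact absurd ⟨h, hpp⟩ hp'

/-- In a rich word every complete return to a letter is a palindrome. -/
theorem IsRichWord.reverse_eq_of_return {α : Type*} {a : α} {t : List α} (hat : a ∉ t)
    (h : IsRichWord (a :: (t ++ [a]))) : t.reverse = t := by
  obtain ⟨p, hp, hpp, hn⟩ := h.exists_new_palindrome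
  cases p with
  | nil => exact absurd List.nil_infix hn
  | cons b p =>
    obtain ⟨rfl, hp⟩ := List.cons_prefix_cons.1 hp
    rcases List.prefix_concat_iff.1 hp with rfl | hp
    · simpa using hpp.symm
    · exfalso
      -- the palindrome ends with its first letter, which does not occur in `t`
      cases p with
      | nil => exact hn (List.suffix_append t [b]).isInfix
      | cons c p =>
        have hmem : b ∈ c :: p := by
          rw [List.reverse_cons] at hpp
          have := congrArg List.getLast? hpp
          rw [List.getLast?_concat, List.getLast?_cons_cons] at this
          exact List.mem_of_getLast? this
        exact hat (hp.subset hmem)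

/-- Square-free words in which every complete return to a letter is a palindrome. Every rich
square-free word is of this kind, and the upper bound holds for all of them. -/
structure IsReturnWord {α : Type*} (w : List α) : Prop where
  sqfree : IsSquareFreeWord w
  ret : ∀ (a : α) (t : List α), a ∉ t → a :: (t ++ [a]) <:+: w → t.reverse = t

theorem IsRichWord.isReturnWord {α : Type*} {w : List α} (h : IsRichWord w)
    (hs : IsSquareFreeWord w) : IsReturnWord w :=
  ⟨hs, fun _ _ hat hi => (h.infix hi).reverse_eq_of_return hat⟩

theorem IsReturnWord.infix {α : Type*} {v w : List α} (hw : IsReturnWord w) (h : v <:+: w) :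
    IsReturnWord v :=
  ⟨hw.sqfree.infix h, fun a t hat hi => hw.ret a t hat (hi.trans h)⟩

theorem IsReturnWord.reverse {α : Type*} {w : List α} (hw : IsReturnWord w) :
    IsReturnWord w.reverse := by
  refine ⟨hw.sqfree.reverse, fun a t hat hi => ?_⟩
  have h1 : a :: (t.reverse ++ [a]) <:+: w := by
    rw [← List.reverse_infix]
    simpa using hi
  have h2 := hw.ret a t.reverse (by simpa using hat) h1
  rw [List.reverse_reverse] at h2
  exact h2.symm

/-! ### Complete returns and the shape `u' z s x s~ z s x v` -/

section Splitting

variable {α : Type*}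

theorem List.eq_reverse_of_palindrome_center {s t : List α} {x : α}
    (h : (s ++ x :: t).reverse = s ++ x :: t) (hs : x ∉ s) (ht : x ∉ t) : t = s.reverse := by
  have h1 : s ++ x :: t = t.reverse ++ x :: s.reverse := by
    rw [← h]
    simp
  exact ((List.append_cons_inj_of_notMem hs ht).1 h1).2.2

theorem List.exists_eq_append_cons_notMem_left {l : List α} {x : α} (h : x ∈ l) :
    ∃ s t, l = s ++ x :: t ∧ x ∉ s := by
  induction l with
  | nil => simp at h
  | cons c l ih =>
    by_cases hc : x = c
    · exact ⟨[], l, by simp [hc], by simp⟩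
    · obtain ⟨s, t, rfl, hs⟩ := ih ((List.mem_cons.1 h).resolve_left hc)
      exact ⟨c :: s, t, rfl, by simp [hc, hs]⟩

theorem List.exists_eq_append_cons_notMem_right {l : List α} {x : α} (h : x ∈ l) :
    ∃ s t, l = s ++ x :: t ∧ x ∉ t := by
  obtain ⟨s, t, hl, hs⟩ := List.exists_eq_append_cons_notMem_left (List.mem_reverse.2 h)
  refine ⟨t.reverse, s.reverse, ?_, by simpa using hs⟩
  rw [← List.reverse_reverse l, hl]
  simp

theorem List.exists_first_of_not_forall {l : List α} {p : α → Prop} (h : ¬ ∀ c ∈ l, p c) :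
    ∃ s e t, l = s ++ e :: t ∧ (∀ c ∈ s, p c) ∧ ¬ p e := by
  induction l with
  | nil => simp at h
  | cons c l ih =>
    by_cases hc : p c
    · have : ¬ ∀ c ∈ l, p c := fun h' => h (by simpa [hc] using h')
      obtain ⟨s, e, t, rfl, hs, he⟩ := ih this
      exact ⟨c :: s, e, t, rfl, by simpa [hc] using hs, he⟩
    · exact ⟨[], c, l, rfl, by simp, hc⟩

theorem List.suffix_of_cons_suffix_of_notMem {s t l : List α} {z : α} (hs : z :: s <:+ l)
    (ht : z :: t <:+ l) (h : z ∉ s) : s <:+ t := by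
  rcases List.suffix_or_suffix_of_suffix hs ht with h1 | h1
  · rcases List.suffix_cons_iff.1 h1 with h2 | h2
    · rw [(List.cons.inj h2).2]
    · exact (List.suffix_cons z s).trans h2
  · rcases List.suffix_cons_iff.1 h1 with h2 | h2
    · rw [(List.cons.inj h2).2]
    · exact absurd (h2.subset (List.mem_cons_self)) h

/-- The letter of `h` whose last occurrence in `u` comes first. -/
theorem List.exists_leftmost_last_occurrence {u h : List α} (hne : h ≠ [])
    (hsub : ∀ c ∈ h, c ∈ u) :
    ∃ u' z s, u = u' ++ z :: s ∧ z ∈ h ∧ z ∉ s ∧ ∀ c ∈ h, c ∈ s ∨ c = z := by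
  induction u with
  | nil =>
    obtain ⟨c, hc⟩ := List.exists_mem_of_ne_nil h hne
    exact absurd (hsub c hc) (by simp)
  | cons c u ih =>
    by_cases hu : ∀ c ∈ h, c ∈ u
    · obtain ⟨u', z, s, rfl, h1⟩ := ih hu
      exact ⟨c :: u', z, s, rfl, h1⟩
    · push Not at hu
      obtain ⟨d, hd, hdu⟩ := hu
      obtain rfl : d = c := (List.mem_cons.1 (hsub d hd)).resolve_right hdu
      exact ⟨[], d, u, rfl, hd, hdu, fun e he => (List.mem_cons.1 (hsub e he)).symm⟩

/-- The last letter of a nonempty word to make its first appearance. -/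
theorem List.exists_last_new_letter {s : List α} (hs : s ≠ []) :
    ∃ s₁ e s₂, s = s₁ ++ e :: s₂ ∧ e ∉ s₁ ∧ ∀ c ∈ s₂, c ∈ s₁ ∨ c = e := by
  have hne : s.reverse ≠ [] := by simpa using hs
  obtain ⟨u', z, t, h, -, hz, ht⟩ := List.exists_leftmost_last_occurrence hne fun c hc => hc
  have hs' : s = t.reverse ++ z :: u'.reverse := by
    rw [← List.reverse_reverse s, h]
    simp
  refine ⟨t.reverse, z, u'.reverse, hs', by simpa using hz, fun c hc => ?_⟩
  simpa using ht c (by rw [h]; simp at hc; simp [hc])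

/-- Two occurrences of `x` in a return word whose letters other than `x` all occur before the
first of them: what precedes the first `x` ends in `z s`, the two are separated by `s~ z s`, and
the letter `z` has disappeared from what follows. -/
theorem IsReturnWord.exists_split {u h v : List α} {x : α}
    (hw : IsReturnWord (u ++ x :: (h ++ x :: v))) (xu : x ∉ u) (xh : x ∉ h)
    (hh : ∀ c ∈ h, c ∈ u) (hv : ∀ c ∈ v, c ∈ u ∨ c = x) :
    ∃ u' z s, u = u' ++ z :: s ∧ h = s.reverse ++ z :: s ∧ z ∉ s ∧ ∀ c ∈ v, c ∈ s ∨ c = x := by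
  obtain ⟨n, hn⟩ : ∃ n, (u ++ x :: (h ++ x :: v)).length ≤ n := ⟨_, le_rfl⟩
  induction n generalizing u h v x with
  | zero => simp at hn
  | succ n ih =>
  have hne : h ≠ [] := by
    rintro rfl
    exact hw.sqfree [x] (by simp) ⟨u, v, by simp⟩
  obtain ⟨u', z, s, rfl, zh, zs, hsz⟩ := List.exists_leftmost_last_occurrence hne hh
  have xz : x ≠ z := fun hxz => xu (by simp [hxz])
  have xs : x ∉ s := fun hxs => xu (by simp [hxs])
  -- the return of `z` across the first `x` is centred at that `x`
  obtain ⟨t₀, t, rfl, zt₀⟩ := List.exists_eq_append_cons_notMem_left zh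
  have xt₀ : x ∉ t₀ := fun h => xh (by simp [h])
  obtain rfl : t₀ = s.reverse := by
    refine List.eq_reverse_of_palindrome_center (x := x) ?_ xs xt₀
    refine hw.ret z _ (by simp [zs, zt₀, xz.symm]) ⟨u', t ++ x :: v, by simp⟩
  have hpal : (s.reverse ++ z :: t).reverse = s.reverse ++ z :: t :=
    hw.ret x _ xh ⟨u' ++ z :: s, v, by simp⟩
  have zt : z ∉ t := by
    intro hzt
    obtain ⟨r, t', rfl, zr⟩ := List.exists_eq_append_cons_notMem_left hzt
    obtain ⟨u₂, z₂, s₂, hs, -, zs₂, ht'⟩ := ih (u := s.reverse) (h := r) (v := t') (x := z)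
      (hw.infix ⟨u' ++ z :: (s ++ [x]), x :: v, by simp⟩) (by simpa using zs) zr
      (fun c hc => by
        rcases hsz c (by simp [hc]) with h1 | rfl
        · simpa using h1
        · exact absurd hc zr)
      (fun c hc => by simpa using hsz c (by simp [hc]))
      (by simp at hn ⊢; omega)
    have hsuf : s <:+ t' := by
      refine List.suffix_of_cons_suffix_of_notMem (z := z)
        (l := s.reverse ++ z :: (r ++ z :: t')) ?_ ⟨s.reverse ++ z :: r, by simp⟩ zs
      rw [← hpal]
      exact ⟨(r ++ z :: t').reverse, by simp⟩
    have hz₂ : z₂ ∈ s := by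
      rw [← List.mem_reverse, hs]
      simp
    rcases ht' z₂ (hsuf.subset hz₂) with h1 | rfl
    · exact zs₂ h1
    · exact zs hz₂
  obtain rfl : t = s := by
    have := List.eq_reverse_of_palindrome_center hpal zt₀ zt
    simpa using this
  refine ⟨u', z, t, rfl, rfl, zs, ?_⟩
  by_contra hcon
  obtain ⟨v₁, e, v₂, rfl, hv₁, he⟩ := List.exists_first_of_not_forall hcon
  push Not at he
  have zv₁ : z ∉ v₁ := fun hz => by
    rcases hv₁ z hz with h1 | h1
    · exact zs h1
    · exact xz h1.symm
  by_cases hez : e = z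
  · subst hez
    have hp : (t ++ x :: v₁).reverse = t ++ x :: v₁ :=
      hw.ret e _ (by simp [zs, zv₁, xz.symm])
        ⟨u' ++ e :: (t ++ x :: t.reverse), v₂, by simp⟩
    by_cases hxv : x ∈ v₁
    · obtain ⟨h₂, v₄, rfl, xh₂⟩ := List.exists_eq_append_cons_notMem_left hxv
      obtain ⟨u₂, z₂, s₂, hs, -, zs₂, ht'⟩ := ih (u := t) (h := h₂) (v := v₄) (x := x)
        (hw.infix ⟨u' ++ e :: (t ++ x :: (t.reverse ++ [e])), e :: v₂, by simp⟩) xs xh₂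
        (fun c hc => by
          rcases hv₁ c (by simp [hc]) with h1 | rfl
          · exact h1
          · exact absurd hc xh₂)
        (fun c hc => hv₁ c (by simp [hc]))
        (by simp at hn ⊢; omega)
      have hsuf : t.reverse <:+ v₄ := by
        refine List.suffix_of_cons_suffix_of_notMem (z := x)
          (l := t ++ x :: (h₂ ++ x :: v₄)) ?_ ⟨t ++ x :: h₂, by simp⟩ (by simpa using xs)
        rw [← hp]
        exact ⟨(h₂ ++ x :: v₄).reverse, by simp⟩
      have hz₂ : z₂ ∈ t := by simp [hs]
      rcases ht' z₂ (hsuf.subset (by simpa using hz₂)) with h1 | rfl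
      · exact zs₂ h1
      · exact xs hz₂
    · obtain rfl := List.eq_reverse_of_palindrome_center hp xs hxv
      exact hw.sqfree (e :: (t ++ x :: t.reverse)) (by simp)
        ⟨u', e :: v₂, by simp⟩
  · -- the return of `e` would read `z … x z x …` on the letters `z` and `x`
    have heu : e ∈ u' := by
      rcases hv e (by simp) with h1 | h1
      · simpa [hez, he.1] using h1
      · exact absurd h1 he.2
    obtain ⟨u₁, u₃, rfl, hu₃⟩ := List.exists_eq_append_cons_notMem_right heu
    have hev : e ∉ v₁ := fun h1 => by
      rcases hv₁ e h1 with h2 | h2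
      · exact he.1 h2
      · exact he.2 h2
    have hp := hw.ret e (u₃ ++ z :: (t ++ x :: (t.reverse ++ z :: (t ++ x :: v₁))))
      (by simp [hu₃, hez, he.1, he.2, hev]) ⟨u₁, v₂, by simp⟩
    have h1 : u₃ ++ z :: t <+: u₃ ++ z :: (t ++ x :: (t.reverse ++ z :: (t ++ x :: v₁))) :=
      ⟨x :: (t.reverse ++ z :: (t ++ x :: v₁)), by simp⟩
    have h2 : v₁.reverse ++ x :: t.reverse <+:
        u₃ ++ z :: (t ++ x :: (t.reverse ++ z :: (t ++ x :: v₁))) := by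
      rw [← hp]
      exact ⟨z :: (t ++ x :: (t.reverse ++ z :: u₃.reverse)), by simp⟩
    have xu₃ : x ∉ u₃ := fun h => xu (by simp [h])
    rcases List.prefix_or_prefix_of_prefix h1 h2 with h3 | h3
    · have : z ∈ v₁.reverse ++ x :: t.reverse := h3.subset (by simp)
      simp [zv₁, zs, xz.symm] at this
    · have : x ∈ u₃ ++ z :: t := h3.subset (by simp)
      simp [xu₃, xs, xz] at this

end Splitting

/-! ### Longest common prefixes -/

section CommonPrefix

variable {α : Type*} [DecidableEq α]

/-- The length of the longest common prefix of two words. -/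
def lcpLen : List α → List α → ℕ
  | a :: s, b :: t => if a = b then lcpLen s t + 1 else 0
  | _, _ => 0

theorem lcpLen_nil_left (t : List α) : lcpLen [] t = 0 := by
  cases t <;> rfl

theorem lcpLen_nil_right (s : List α) : lcpLen s [] = 0 := by
  cases s <;> rfl

theorem lcpLen_cons_cons (a b : α) (s t : List α) :
    lcpLen (a :: s) (b :: t) = if a = b then lcpLen s t + 1 else 0 :=
  rfl

theorem lcpLen_comm (s t : List α) : lcpLen s t = lcpLen t s := by
  induction s generalizing t with
  | nil => rw [lcpLen_nil_left, lcpLen_nil_right]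
  | cons a s ih =>
    cases t with
    | nil => rfl
    | cons b t => simp only [lcpLen_cons_cons, ih t, eq_comm]

theorem lcpLen_le_left (s t : List α) : lcpLen s t ≤ s.length := by
  induction s generalizing t with
  | nil => simp [lcpLen_nil_left]
  | cons a s ih =>
    cases t with
    | nil => simp [lcpLen_nil_right]
    | cons b t =>
      have := ih t
      rw [lcpLen_cons_cons]
      split_ifs <;> simp [this]

theorem lcpLen_le_right (s t : List α) : lcpLen s t ≤ t.length :=
  lcpLen_comm s t ▸ lcpLen_le_left t s

theorem lcpLen_append_append (p s t : List α) :
    lcpLen (p ++ s) (p ++ t) = p.length + lcpLen s t := by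
  induction p with
  | nil => simp
  | cons a p ih =>
    simp only [List.cons_append, lcpLen_cons_cons, ih, if_true, List.length_cons]
    omega

theorem take_eq_take_of_le_lcpLen {s t : List α} {i : ℕ} (h : i ≤ lcpLen s t) :
    s.take i = t.take i := by
  induction i generalizing s t with
  | zero => simp
  | succ i ih =>
    cases s with
    | nil => simp [lcpLen_nil_left] at h
    | cons a s =>
      cases t with
      | nil => simp [lcpLen_nil_right] at h
      | cons b t =>
        rw [lcpLen_cons_cons] at h
        split_ifs at h with hab
        · rw [List.take_succ_cons, List.take_succ_cons, hab, ih (Nat.le_of_succ_le_succ h)]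
        · omega

theorem length_le_lcpLen {p s t : List α} (hs : p <+: s) (ht : p <+: t) :
    p.length ≤ lcpLen s t := by
  obtain ⟨s, rfl⟩ := hs
  obtain ⟨t, rfl⟩ := ht
  rw [lcpLen_append_append]
  omega

theorem lcpLen_append_cons_of_notMem {r s v : List α} {z : α} (h : z ∉ r) :
    lcpLen r (s ++ z :: v) = lcpLen r s := by
  induction r generalizing s with
  | nil => rw [lcpLen_nil_left, lcpLen_nil_left]
  | cons a r ih =>
    have ha : a ≠ z := fun h' => h (by simp [h'])
    cases s with
    | nil => simp [lcpLen_cons_cons, ha, lcpLen_nil_right]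
    | cons b s =>
      rw [List.cons_append, lcpLen_cons_cons, lcpLen_cons_cons,
        ih fun h' => h (List.mem_cons_of_mem a h')]

/-- If the two overlaps were to cover `s`, the word would contain a square of period
`2 * s.length + 2`. -/
theorem IsSquareFreeWord.lcpLen_add_lcpLen_lt {r s v : List α} {y z : α}
    (hw : IsSquareFreeWord (r.reverse ++ y :: (s ++ z :: (s.reverse ++ y :: (s ++ z :: v))))) :
    lcpLen r s + lcpLen s.reverse v < s.length := by
  by_contra hcon
  have hj := lcpLen_le_left s.reverse v
  rw [List.length_reverse] at hj
  set j := lcpLen s.reverse v with hjdef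
  obtain ⟨a, b, rfl, hb⟩ : ∃ a b, s = a ++ b ∧ b.length = j :=
    ⟨s.take (s.length - j), s.drop (s.length - j), by simp, by simp; omega⟩
  rw [List.length_append] at hcon hj
  have hr : a <+: r := by
    have h1 := take_eq_take_of_le_lcpLen (s := r) (t := a ++ b) (i := a.length) (by omega)
    rw [List.take_left] at h1
    exact h1 ▸ List.take_prefix _ _
  have hv : b.reverse <+: v := by
    have h1 := take_eq_take_of_le_lcpLen (s := (a ++ b).reverse) (t := v)
      (i := b.reverse.length) (by rw [List.length_reverse]; omega)
    rw [List.reverse_append, List.take_left] at h1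
    exact h1 ▸ List.take_prefix _ _
  obtain ⟨r', rfl⟩ := hr
  obtain ⟨v', rfl⟩ := hv
  exact hw (a.reverse ++ y :: (a ++ b ++ z :: b.reverse)) (by simp) ⟨r'.reverse, v', by simp⟩

end CommonPrefix

/-! ### Linear inequalities for words `s~ z u` -/

section Config

variable {α : Type*} [DecidableEq α]

/-- The bound `|w| + 1 ≤ 2.237 ^ k` for the return words over at most `k` letters, `k ≤ n`. -/
def LengthBoundUpTo (α : Type*) [DecidableEq α] (n : ℕ) : Prop :=
  ∀ k ≤ n, ∀ w : List α, IsReturnWord w → w.toFinset.card ≤ k →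
    (w.length : ℝ) + 1 ≤ 2.237 ^ k

theorem LengthBoundUpTo.mono {m n : ℕ} (h : LengthBoundUpTo α n) (hmn : m ≤ n) :
    LengthBoundUpTo α m :=
  fun k hk => h k (hk.trans hmn)

/-- What is known about a return word `s~ z u`, where `z` does not occur in `s` and all letters
of `u` other than `z` occur in `s`. Here `a` and `c` are one more than the length of the longest
common prefix of `s` and `u` and than the length of `s`, the number `b` is the length of the rest
of `u` (so `a + b` is one more than the length of `u`), and `F` is the bound for words over the
letters of `s`. One of three groups of linear inequalities holds, according to the way in which
`u` continues `s~ z`: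
* `u` is short, as it misses a letter of `s` or is composed of words over few letters;
* `z` does not occur in `u`, and `s` and `u` share all but their last parts;
* `z` occurs in `u`, and the word is composed of two such words over one letter less.

Division by `2.237` stands for the passage to the bound for one letter less. The constants of the
third group are rounded so that it reproduces itself (`ConfigBound.combine`) and still gives the
final estimate (`ConfigBound.total_le`). -/
structure ConfigBound (F a b c : ℝ) : Prop where
  a_nonneg : 0 ≤ a
  b_nonneg : 0 ≤ b
  a_le_c : a ≤ c
  c_le : c ≤ F
  cases : (b ≤ F / 2.237 ∧ a + b ≤ F / 2.237 + F / 2.237 ^ 2) ∨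
    (b ≤ F / 2.237 + F / 2.237 ^ 2 ∧ a + b ≤ F ∧
      b + c - a ≤ 2 * (F / 2.237) + F / 2.237 ^ 2) ∨
    (b - a + 2 * c ≤ 1.9 * F ∧ b - 2 * a + 2 * c ≤ 1.5 * F ∧
      2 * b - 2 * a + c ≤ 1.85 * F ∧ a + b ≤ 1.45 * F)

/-- Two bounded configurations at the next smaller scale that share the middle word fit together
into a bounded configuration: a finite check in linear programming. -/
theorem ConfigBound.combine {F a b c a' b' : ℝ} (h : ConfigBound (F / 2.237) a b c)
    (h' : ConfigBound (F / 2.237) a' b' c) (hQ : a + a' ≤ c) (hs : c + a + b ≤ F)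
    (hv : c + a' + b' ≤ F) : ConfigBound F (c + a) (c - a + (a' + b')) (c + a + b) := by
  have e (x : ℝ) : x / 2.237 = 1000 / 2237 * x := by ring
  have e' (x : ℝ) : x / 2.237 ^ 2 = 1000000 / 5004169 * x := by ring
  obtain ⟨h1, h2, h3, h4, h5⟩ := h
  obtain ⟨h1', h2', h3', h4', h5'⟩ := h'
  simp only [e, e'] at h4 h5 h4' h5'
  refine ⟨by linarith, by linarith, by linarith, hs, Or.inr (Or.inr ?_)⟩
  rcases h5 with ⟨h5, h6⟩ | ⟨h5, h6, h7⟩ | ⟨h5, h6, h7, h8⟩ <;>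
    rcases h5' with ⟨h5', h6'⟩ | ⟨h5', h6', h7'⟩ | ⟨h5', h6', h7', h8'⟩ <;>
    (refine ⟨?_, ?_, ?_, ?_⟩ <;> linarith)

/-- The linear programming bound for a whole word `u' z s x s~ z s x v`, whose length is `3 * c`
plus the lengths of `u'` and `v`, up to constants. -/
theorem ConfigBound.total_le {F a b c a' b' : ℝ} (h : ConfigBound F a b c)
    (h' : ConfigBound F a' b' c) (hQ : a + a' ≤ c) (hs : c + a + b ≤ 2.237 * F)
    (hv : c + a' + b' ≤ 2.237 * F) : 3 * c + (a + b) + (a' + b') ≤ 2.237 ^ 2 * F := by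
  have e (x : ℝ) : x / 2.237 = 1000 / 2237 * x := by ring
  have e' (x : ℝ) : x / 2.237 ^ 2 = 1000000 / 5004169 * x := by ring
  obtain ⟨h1, h2, h3, h4, h5⟩ := h
  obtain ⟨h1', h2', h3', h4', h5'⟩ := h'
  simp only [e, e'] at h5 h5'
  rcases h5 with ⟨h5, h6⟩ | ⟨h5, h6, h7⟩ | ⟨h5, h6, h7, h8⟩ <;>
    rcases h5' with ⟨h5', h6'⟩ | ⟨h5', h6', h7'⟩ | ⟨h5', h6', h7', h8'⟩ <;> linarith

theorem List.card_toFinset_insert {s : List α} {z : α} (h : z ∉ s) :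
    (insert z s.toFinset).card = s.toFinset.card + 1 :=
  Finset.card_insert_of_notMem (by simpa using h)

/-- If all letters of `s₂` occur in `s₁ e`, then either `s₂` obeys the bound for one letter less,
or it exceeds that bound by at most the length of a word `t` which misses two letters and is a
prefix of both `s₂` and the reversal of `s₁`. -/
theorem IsReturnWord.length_le_or_exists_prefix {m : ℕ} {s₁ s₂ : List α} {e : α}
    (B : LengthBoundUpTo α m) (hw : IsReturnWord (s₁ ++ e :: s₂)) (he : e ∉ s₁)
    (hs : ∀ c ∈ s₂, c ∈ s₁ ∨ c = e) (hm : s₁.toFinset.card + 1 ≤ m) :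
    (s₂.length : ℝ) + 1 ≤ 2.237 ^ m / 2.237 ∨
      ∃ t, t <+: s₂ ∧ t <+: s₁.reverse ∧ (t.length : ℝ) + 1 ≤ 2.237 ^ m / 2.237 ^ 2 ∧
        (s₂.length : ℝ) ≤ 2.237 ^ m / 2.237 + t.length := by
  obtain ⟨m, rfl⟩ : ∃ k, m = k + 1 := ⟨m - 1, by omega⟩
  have e1 : (2.237 : ℝ) ^ (m + 1) / 2.237 = 2.237 ^ m := by rw [pow_succ]; field
  rw [e1]
  by_cases hes : e ∈ s₂
  · right
    obtain ⟨h, v, rfl, heh⟩ := List.exists_eq_append_cons_notMem_left hes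
    obtain ⟨u', z, t, rfl, rfl, hz, hv⟩ := hw.exists_split he heh
      (fun c hc => (hs c (by simp [hc])).resolve_right fun hce => heh (hce ▸ hc))
      (fun c hc => hs c (by simp [hc]))
    have het : e ∉ t := fun h => he (by simp [h])
    have hcard : t.toFinset.card + 1 ≤ m := by
      rw [← List.card_toFinset_insert hz]
      refine (Finset.card_le_card (t := (u' ++ z :: t).toFinset) ?_).trans (by omega)
      intro c
      simp only [Finset.mem_insert, List.mem_toFinset, List.mem_append, List.mem_cons]
      tauto
    obtain ⟨m, rfl⟩ : ∃ k, m = k + 1 := ⟨m - 1, by omega⟩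
    have e2 : (2.237 : ℝ) ^ (m + 1 + 1) / 2.237 ^ 2 = 2.237 ^ m := by
      rw [pow_succ, pow_succ]; field
    have b1 : (t.length : ℝ) + 1 ≤ 2.237 ^ m :=
      B m (by omega) t (hw.infix ⟨u' ++ [z], e :: (t.reverse ++ z :: t ++ e :: v), by simp⟩)
        (by omega)
    have b2 : ((t ++ e :: v).length : ℝ) + 1 ≤ 2.237 ^ (m + 1) := by
      refine B (m + 1) (by omega) _
        (hw.infix ⟨u' ++ z :: t ++ e :: (t.reverse ++ [z]), [], by simp⟩) ?_
      refine (Finset.card_le_card (t := insert e t.toFinset) ?_).trans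
        ((List.card_toFinset_insert het).le.trans (by omega))
      intro c
      simp only [Finset.mem_insert, List.mem_toFinset, List.mem_append, List.mem_cons]
      have := hv c
      tauto
    refine ⟨t.reverse, ⟨z :: t ++ e :: v, by simp⟩, ⟨z :: u'.reverse, by simp⟩, ?_, ?_⟩
    · rw [e2, List.length_reverse]
      exact b1
    · simp only [List.length_append, List.length_cons, List.length_reverse, Nat.cast_add,
        Nat.cast_one] at b2 ⊢
      linarith
  · left
    refine B m (by omega) s₂ (hw.infix ⟨s₁ ++ [e], [], by simp⟩) ?_
    refine (Finset.card_le_card (t := s₁.toFinset) ?_).trans (by omega)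
    intro c
    simp only [List.mem_toFinset]
    intro hc
    exact (hs c hc).resolve_right fun hce => hes (hce ▸ hc)

/-- If `z` occurs in `u`, then `s = t~ y r` and `u = t~ y t z v`, and the words `t~ y r` and `t z v`
are treated by induction. If it does not, the return of the last new letter `e` of `s` across `z`
shows that `u` starts with the part of `s` up to `e`, unless `e` is missing from `u`. -/
theorem IsReturnWord.configBound {n : ℕ} (B : LengthBoundUpTo α n) {s u : List α} {z : α}
    (hw : IsReturnWord (s.reverse ++ z :: u)) (hz : z ∉ s) (hu : ∀ c ∈ u, c ∈ s ∨ c = z)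
    (hn : s.toFinset.card ≤ n) :
    ConfigBound (2.237 ^ s.toFinset.card) (lcpLen s u + 1) (u.length - lcpLen s u)
      (s.length + 1) := by
  obtain ⟨m, hm⟩ : ∃ m, s.toFinset.card = m := ⟨_, rfl⟩
  rw [hm]
  induction m generalizing s u z with
  | zero =>
    obtain rfl : s = [] := by simpa using hm
    obtain rfl : u = [] := by
      cases u with
      | nil => rfl
      | cons c u =>
        obtain rfl : c = z := by simpa using hu c (by simp)
        exact absurd ⟨[], u, by simp⟩ (hw.sqfree [c] (by simp))
    refine ⟨?_, ?_, ?_, ?_, Or.inr (Or.inl ⟨?_, ?_, ?_⟩)⟩ <;> norm_num [lcpLen_nil_left]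
  | succ m ih =>
  have hF : (0 : ℝ) < 2.237 ^ m := by positivity
  have eG : (2.237 : ℝ) ^ (m + 1) / 2.237 = 2.237 ^ m := by rw [pow_succ]; field
  have hmn : m + 1 ≤ n := hm ▸ hn
  have hlen_s : (s.length : ℝ) + 1 ≤ 2.237 ^ (m + 1) :=
    B _ hmn s (by simpa using (hw.infix ⟨[], z :: u, by simp⟩ : IsReturnWord s.reverse).reverse)
      hm.le
  have hl1 : (lcpLen s u : ℝ) ≤ s.length := by exact_mod_cast lcpLen_le_left s u
  have hl2 : (lcpLen s u : ℝ) ≤ u.length := by exact_mod_cast lcpLen_le_right s u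
  have hl0 : (0 : ℝ) ≤ lcpLen s u := by positivity
  have hwu : IsReturnWord u := hw.infix ⟨s.reverse ++ [z], [], by simp⟩
  by_cases hzu : z ∈ u
  · -- here both ends grow out of a shorter configuration
    obtain ⟨h, v, rfl, hzh⟩ := List.exists_eq_append_cons_notMem_left hzu
    obtain ⟨r', y, t, hs, rfl, hy, hv⟩ := hw.exists_split (by simpa using hz) hzh
      (fun c hc => by
        simpa using (hu c (by simp [hc])).resolve_right fun hcz => hzh (hcz ▸ hc))
      (fun c hc => by simpa using hu c (by simp [hc]))
    obtain ⟨r, rfl⟩ : ∃ r, r' = r.reverse := ⟨r'.reverse, by simp⟩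
    obtain rfl : s = t.reverse ++ y :: r := by
      rw [← List.reverse_reverse s, hs]
      simp
    have hzr : z ∉ r := fun h => hz (by simp [h])
    have hzt : z ∉ t := fun h => hz (by simp [h])
    have hsub : insert y t.toFinset ⊆ (t.reverse ++ y :: r).toFinset := by
      intro c
      simp only [Finset.mem_insert, List.mem_toFinset, List.mem_append, List.mem_cons,
        List.mem_reverse]
      tauto
    have hcard := Finset.card_le_card hsub
    rw [List.card_toFinset_insert hy, hm] at hcard
    have hlcp : lcpLen (t.reverse ++ y :: r) (t.reverse ++ y :: t ++ z :: v) =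
        t.length + 1 + lcpLen r t := by
      have h1 : t.reverse ++ y :: r = (t.reverse ++ [y]) ++ r := by simp
      have h2 : t.reverse ++ y :: t ++ z :: v = (t.reverse ++ [y]) ++ (t ++ z :: v) := by simp
      rw [h1, h2, lcpLen_append_append, lcpLen_append_cons_of_notMem hzr]
      simp
    have hwtv : IsReturnWord (t ++ z :: v) :=
      hw.infix ⟨(t.reverse ++ y :: r).reverse ++ z :: (t.reverse ++ [y]), [], by simp⟩
    have hwt : IsReturnWord t := hwtv.infix ⟨[], z :: v, by simp⟩
    have hcard_tv : (t ++ z :: v).toFinset.card ≤ t.toFinset.card + 1 := by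
      rw [← List.card_toFinset_insert hzt]
      refine Finset.card_le_card ?_
      intro c
      simp only [Finset.mem_insert, List.mem_toFinset, List.mem_append, List.mem_cons]
      have := hv c
      tauto
    rw [hlcp] at hl1 hl2 hl0 ⊢
    simp only [List.length_append, List.length_cons, List.length_reverse, Nat.cast_add,
      Nat.cast_one] at hl1 hl2 hl0 hlen_s ⊢
    rcases Nat.lt_or_ge t.toFinset.card m with hlt | hge
    · obtain ⟨m, rfl⟩ : ∃ k, m = k + 1 := ⟨m - 1, by omega⟩
      have eH : (2.237 : ℝ) ^ (m + 1 + 1) / 2.237 ^ 2 = 2.237 ^ m := by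
        rw [pow_succ, pow_succ]; field
      have b1 := B m (by omega) t hwt (by omega)
      have b2 := B (m + 1) (by omega) _ hwtv (by omega)
      simp only [List.length_append, List.length_cons, Nat.cast_add, Nat.cast_one] at b2
      refine ⟨by linarith, by linarith, by linarith, by linarith, Or.inl ?_⟩
      rw [eG, eH]
      have : (0 : ℝ) ≤ lcpLen r t := by positivity
      constructor <;> linarith
    · have htm : t.toFinset.card = m := by omega
      have hsub' : (t.reverse ++ y :: r).toFinset ⊆ insert y t.toFinset := by
        refine (Finset.eq_of_subset_of_card_le hsub ?_).ge
        rw [List.card_toFinset_insert hy, hm]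
        omega
      have hr : ∀ c ∈ r, c ∈ t ∨ c = y := fun c hc => by
        have : c ∈ insert y t.toFinset := hsub' (by simp [hc])
        simpa [or_comm] using this
      have c1 := ih (s := t) (u := r) (z := y)
        (by
          have := (hw.infix ⟨[], z :: (t.reverse ++ y :: t ++ z :: v), by simp⟩ :
            IsReturnWord (t.reverse ++ y :: r).reverse).reverse
          simpa using this) hy hr (by omega) htm
      have c2 := ih (s := t.reverse) (u := v) (z := z) (by simpa using hwtv)
        (by simpa using hzt) (fun c hc => by simpa using hv c hc)
        (by rw [List.toFinset_reverse]; omega) (by rw [List.toFinset_reverse, htm])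
      have hQ : lcpLen r t + lcpLen t.reverse v < t.length := by
        have h1 := hw.sqfree
        refine IsSquareFreeWord.lcpLen_add_lcpLen_lt (y := y) (z := z) ?_
        simpa using h1
      have hQ' : (lcpLen t r : ℝ) + 1 + (lcpLen t.reverse v + 1) ≤ t.length + 1 := by
        rw [lcpLen_comm t r]
        exact_mod_cast (by omega :
          lcpLen r t + 1 + (lcpLen t.reverse v + 1) ≤ t.length + 1)
      have b2 := B (m + 1) (by omega) _ hwtv (by omega)
      simp only [List.length_append, List.length_cons, Nat.cast_add, Nat.cast_one] at b2
      rw [List.length_reverse, ← eG] at c2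
      rw [← eG] at c1
      have := c1.combine c2 hQ' (by linarith) (by linarith)
      rw [lcpLen_comm t r] at this
      convert this using 1 <;> ring
  · have hus : ∀ c ∈ u, c ∈ s := fun c hc =>
      (hu c hc).resolve_right fun hcz => hzu (hcz ▸ hc)
    have hlen_u : (u.length : ℝ) + 1 ≤ 2.237 ^ (m + 1) := by
      refine B _ hmn u hwu ((Finset.card_le_card (t := s.toFinset) ?_).trans hm.le)
      intro c
      simpa using hus c
    have hsne : s ≠ [] := by
      rintro rfl
      simp at hm
    obtain ⟨s₁, e, s₂, rfl, hes₁, hs₂⟩ := List.exists_last_new_letter hsne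
    have hcard : s₁.toFinset.card + 1 = m + 1 := by
      rw [← hm, ← List.card_toFinset_insert hes₁]
      congr 1
      ext c
      have := hs₂ c
      simp only [Finset.mem_insert, List.mem_toFinset, List.mem_append, List.mem_cons]
      tauto
    have hs₁u : ∀ c ∈ u, c ≠ e → c ∈ s₁ := fun c hc hce => by
      have h1 := hus c hc
      have h2 := hs₂ c
      simp only [List.mem_append, List.mem_cons] at h1
      tauto
    by_cases heu : e ∈ u
    · obtain ⟨t, u₂, rfl, het⟩ := List.exists_eq_append_cons_notMem_left heu
      have hzs₁ : z ∉ s₁ := fun h => hz (by simp [h])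
      have hez : e ≠ z := fun h => hz (by simp [h])
      have hzt : z ∉ t := fun h => hzu (by simp [h])
      -- the return of `e` across `z` is centred at `z`
      obtain rfl : t = s₁ := by
        have h1 := hw.ret e (s₁.reverse ++ z :: t) (by simp [hes₁, het, hez])
          ⟨s₂.reverse, u₂, by simp⟩
        simpa using List.eq_reverse_of_palindrome_center h1 (by simpa using hzs₁) hzt
      have hu₂ : ∀ c ∈ u₂, c ∈ t ∨ c = e := fun c hc => by
        by_cases hce : c = e
        · exact Or.inr hce
        · exact Or.inl (hs₁u c (by simp [hc]) hce)
      have hlcp : lcpLen (t ++ e :: s₂) (t ++ e :: u₂) = t.length + 1 + lcpLen s₂ u₂ := by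
        have h1 : t ++ e :: s₂ = (t ++ [e]) ++ s₂ := by simp
        have h2 : t ++ e :: u₂ = (t ++ [e]) ++ u₂ := by simp
        rw [h1, h2, lcpLen_append_append]
        simp
      have d1 := IsReturnWord.length_le_or_exists_prefix (B.mono hmn)
        (by
          have := (hw.infix ⟨[], z :: (t ++ e :: u₂), by simp⟩ :
            IsReturnWord (t ++ e :: s₂).reverse).reverse
          rwa [List.reverse_reverse] at this) hes₁ hs₂ hcard.le
      have d2 := IsReturnWord.length_le_or_exists_prefix (B.mono hmn) hwu hes₁ hu₂ hcard.le
      have h0 : (0 : ℝ) ≤ lcpLen s₂ u₂ := by positivity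
      have hH : (0 : ℝ) < 2.237 ^ (m + 1) / 2.237 ^ 2 := by positivity
      rw [hlcp] at hl1 hl2 hl0 ⊢
      simp only [List.length_append, List.length_cons, Nat.cast_add,
        Nat.cast_one] at hl1 hl2 hl0 hlen_s hlen_u ⊢
      refine ⟨by linarith, by linarith, by linarith, by linarith, Or.inr (Or.inl ?_)⟩
      rcases d1 with d1 | ⟨p, p1, p2, p3, p4⟩ <;> rcases d2 with d2 | ⟨p', p1', p2', p3', p4'⟩
      · exact ⟨by linarith, by linarith, by linarith⟩
      · exact ⟨by linarith, by linarith, by linarith⟩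
      · exact ⟨by linarith, by linarith, by linarith⟩
      · have hq : (0 : ℝ) ≤ p.length := by positivity
        have hq' : (0 : ℝ) ≤ p'.length := by positivity
        -- the shorter of the two prefixes of the reversal of `t` is common to `s₂` and `u₂`
        rcases List.prefix_or_prefix_of_prefix p2 p2' with h | h
        · have : (p.length : ℝ) ≤ lcpLen s₂ u₂ := by
            exact_mod_cast length_le_lcpLen p1 (h.trans p1')
          exact ⟨by linarith, by linarith, by linarith⟩
        · have : (p'.length : ℝ) ≤ lcpLen s₂ u₂ := by
            exact_mod_cast length_le_lcpLen (h.trans p1) p1'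
          exact ⟨by linarith, by linarith, by linarith⟩
    · have hlen : (u.length : ℝ) + 1 ≤ 2.237 ^ m := by
        refine B m (by omega) u hwu ((Finset.card_le_card (t := s₁.toFinset) ?_).trans
          (by omega))
        intro c
        simp only [List.mem_toFinset]
        intro hc
        exact hs₁u c hc fun hce => heu (hce ▸ hc)
      have hH : (0 : ℝ) < 2.237 ^ (m + 1) / 2.237 ^ 2 := by positivity
      refine ⟨by linarith, by linarith, by linarith, hlen_s, Or.inl ?_⟩
      rw [eG]
      exact ⟨by linarith, by linarith⟩

end Config

/-! ### The upper bound -/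

/-- Let `x` be the last letter to appear in `w`, say `w = u x v'` with `u` over one letter less.
If `x` occurs again, `w = u' z s x s~ z s x v`, and the two sides `s~ z u'~` and `s x v` obey the
linear inequalities. -/
theorem lengthBoundUpTo (α : Type*) [DecidableEq α] (n : ℕ) : LengthBoundUpTo α n := by
  induction n with
  | zero =>
    intro k hk w _ hcard
    obtain rfl : k = 0 := by omega
    obtain rfl : w = [] := by simpa using hcard
    simp
  | succ n B =>
  intro k hk w hw hcard
  rcases Nat.lt_or_ge k (n + 1) with hlt | hge
  · exact B k (by omega) w hw hcard
  obtain rfl : k = n + 1 := by omega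
  rcases Nat.lt_or_ge w.toFinset.card (n + 1) with hlt | hge
  · exact (B n le_rfl w hw (by omega)).trans
      (pow_le_pow_right₀ (by norm_num) (Nat.le_succ n))
  have hne : w ≠ [] := by
    rintro rfl
    simp at hge
  obtain ⟨u, x, v', rfl, hxu, hv'⟩ := List.exists_last_new_letter hne
  have hcu : u.toFinset.card = n := by
    have h1 : (u ++ x :: v').toFinset = insert x u.toFinset := by
      ext c
      have := hv' c
      simp only [Finset.mem_insert, List.mem_toFinset, List.mem_append, List.mem_cons]
      tauto
    rw [h1, List.card_toFinset_insert hxu] at hcard hge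
    omega
  have hF : (0 : ℝ) < 2.237 ^ n := by positivity
  have b1 := B n le_rfl u (hw.infix ⟨[], x :: v', by simp⟩) hcu.le
  by_cases hxv : x ∈ v'
  · obtain ⟨h, v, rfl, hxh⟩ := List.exists_eq_append_cons_notMem_left hxv
    obtain ⟨u', z, s, rfl, rfl, hz, hv⟩ := hw.exists_split hxu hxh
      (fun c hc => (hv' c (by simp [hc])).resolve_right fun hcx => hxh (hcx ▸ hc))
      (fun c hc => hv' c (by simp [hc]))
    have hxs : x ∉ s := fun h => hxu (by simp [h])
    have hsub : insert z s.toFinset ⊆ (u' ++ z :: s).toFinset := by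
      intro c
      simp only [Finset.mem_insert, List.mem_toFinset, List.mem_append, List.mem_cons]
      tauto
    have hcs := Finset.card_le_card hsub
    rw [List.card_toFinset_insert hz, hcu] at hcs
    obtain ⟨m, rfl⟩ : ∃ k, n = k + 1 := ⟨n - 1, by omega⟩
    have hws : IsReturnWord (s ++ x :: v) :=
      hw.infix ⟨u' ++ z :: s ++ x :: (s.reverse ++ [z]), [], by simp⟩
    have hcsv : (s ++ x :: v).toFinset.card ≤ s.toFinset.card + 1 := by
      rw [← List.card_toFinset_insert hxs]
      refine Finset.card_le_card ?_
      intro c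
      simp only [Finset.mem_insert, List.mem_toFinset, List.mem_append, List.mem_cons]
      have := hv c
      tauto
    simp only [List.length_append, List.length_cons, List.length_reverse, Nat.cast_add,
      Nat.cast_one] at b1 ⊢
    rcases Nat.lt_or_ge s.toFinset.card m with hlt | hge
    · obtain ⟨m, rfl⟩ : ∃ k, m = k + 1 := ⟨m - 1, by omega⟩
      have b2 := B m (by omega) s (hws.infix ⟨[], x :: v, by simp⟩) (by omega)
      have b3 := B (m + 1) (by omega) _ hws (by omega)
      simp only [List.length_append, List.length_cons, Nat.cast_add, Nat.cast_one] at b3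
      rw [pow_succ] at b1 b3
      rw [pow_succ, pow_succ, pow_succ]
      rw [pow_succ] at b1 hF
      have hF' : (0 : ℝ) < 2.237 ^ m := by positivity
      linarith
    · have hcs' : s.toFinset.card = m := by omega
      have hsub' : (u' ++ z :: s).toFinset ⊆ insert z s.toFinset := by
        refine (Finset.eq_of_subset_of_card_le hsub ?_).ge
        rw [List.card_toFinset_insert hz, hcu]
        omega
      have hu' : ∀ c ∈ u'.reverse, c ∈ s ∨ c = z := fun c hc => by
        have : c ∈ insert z s.toFinset := hsub' (by simp at hc; simp [hc])
        simpa [or_comm] using this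
      have c1 := IsReturnWord.configBound B (s := s) (u := u'.reverse) (z := z)
        (by
          have := (hw.infix ⟨[], x :: (s.reverse ++ z :: s ++ x :: v), by simp⟩ :
            IsReturnWord (u' ++ z :: s)).reverse
          simpa using this) hz hu' (by omega)
      have c2 := IsReturnWord.configBound B (s := s.reverse) (u := v) (z := x)
        (by simpa using hws) (by simpa using hxs) (fun c hc => by simpa using hv c hc)
        (by rw [List.toFinset_reverse]; omega)
      rw [hcs'] at c1
      rw [List.toFinset_reverse, hcs'] at c2
      have hQ : lcpLen u'.reverse s + lcpLen s.reverse v < s.length := by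
        have h1 := hw.sqfree
        refine IsSquareFreeWord.lcpLen_add_lcpLen_lt (y := z) (z := x) ?_
        simpa using h1
      have hQ' : (lcpLen s u'.reverse : ℝ) + 1 + (lcpLen s.reverse v + 1) ≤ s.length + 1 := by
        rw [lcpLen_comm s]
        exact_mod_cast (by omega :
          lcpLen u'.reverse s + 1 + (lcpLen s.reverse v + 1) ≤ s.length + 1)
      have b3 := B (m + 1) (by omega) _ hws (by omega)
      simp only [List.length_append, List.length_cons, Nat.cast_add, Nat.cast_one] at b3
      rw [List.length_reverse] at c1 c2
      rw [pow_succ] at b1 b3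
      have := c1.total_le c2 hQ' (by linarith) (by linarith)
      rw [pow_succ, pow_succ]
      linarith
  · have b2 := B n le_rfl v' (hw.infix ⟨u ++ [x], [], by simp⟩) (by
      refine (Finset.card_le_card (t := u.toFinset) ?_).trans hcu.le
      intro c
      simp only [List.mem_toFinset]
      intro hc
      exact (hv' c hc).resolve_right fun hcx => hxv (hcx ▸ hc))
    simp only [List.length_append, List.length_cons, Nat.cast_add, Nat.cast_one]
    rw [pow_succ]
    linarith

theorem IsRichWord.length_add_one_le {n : ℕ} {w : List (Fin n)} (h : IsRichWord w)
    (hs : IsSquareFreeWord w) : (w.length : ℝ) + 1 ≤ 2.237 ^ n := by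
  refine lengthBoundUpTo (Fin n) n n le_rfl w (h.isReturnWord hs) ?_
  simpa using Finset.card_le_univ w.toFinset

theorem isGreatest_maxRichSquareFreeLength (n : ℕ) :
    IsGreatest (richSquareFreeLengths n) (maxRichSquareFreeLength n) := by
  have hne : (richSquareFreeLengths n).Nonempty := by
    refine ⟨0, [], ?_, ?_, rfl⟩
    · simp [IsRichWord, palFactors_nil]
    · intro u hu h
      simp [hu] at h
  have hbdd : BddAbove (richSquareFreeLengths n) := by
    refine ⟨⌊(2.237 : ℝ) ^ n⌋₊, ?_⟩
    rintro l ⟨w, hr, hs, rfl⟩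
    have := hr.length_add_one_le hs
    exact Nat.le_floor (by linarith)
  exact ⟨Nat.sSup_mem hne hbdd, fun l hl => le_csSup hbdd hl⟩

/-! ### A long word over five letters -/

theorem IsRichWord.cons {α : Type*} {x : α} {w p : List α} (hw : IsRichWord w)
    (hp : p <+: x :: w) (hpal : p = p.reverse) (hn : ¬ p <:+: w) : IsRichWord (x :: w) := by
  refine IsRichWord.of_le ?_
  have h1 : (palFactors w).ncard < (palFactors (x :: w)).ncard := by
    refine Set.ncard_lt_ncard ⟨palFactors_subset_cons x w, fun h => ?_⟩ (palFactors_finite _)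
    exact hn (h ⟨hp.isInfix, hpal⟩).1
  rw [IsRichWord] at hw
  rw [List.length_cons]
  omega

theorem isRichWord_of_forall_tails {α : Type*} {w : List α}
    (h : ∀ t ∈ w.tails, t ≠ [] → ∃ p ∈ t.inits, p = p.reverse ∧ ¬ p <:+: t.tail) :
    IsRichWord w := by
  induction w with
  | nil => simp [IsRichWord, palFactors_nil]
  | cons x w ih =>
    obtain ⟨p, hp, hpal, hn⟩ := h (x :: w) (by simp) (by simp)
    exact (ih fun t ht => h t (by simp at ht ⊢; exact Or.inr ht)).cons
      ((List.mem_inits _ _).1 hp) hpal hn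

theorem isSquareFreeWord_of_forall_tails {α : Type*} {w : List α}
    (h : ∀ t ∈ w.tails, ∀ p ∈ t.inits, p ≠ [] → ¬ p ++ p <+: t) : IsSquareFreeWord w := by
  rintro u hu ⟨s, t, rfl⟩
  refine h (u ++ u ++ t) ?_ u ?_ hu (List.prefix_append _ _)
  · rw [List.mem_tails]
    exact ⟨s, by simp⟩
  · rw [List.mem_inits]
    exact ⟨u ++ t, by simp⟩

/-- A rich square-free word of length 33 over five letters. -/
def longWord : List (Fin 5) :=
  [0, 1, 2, 1, 0, 1, 2, 3, 2, 1, 2, 3, 4, 3, 2, 1, 2, 3, 2, 1, 0, 1, 2, 3, 2, 1, 2, 3, 4, 3, 2, 1,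
    2]

theorem isRichWord_longWord : IsRichWord longWord :=
  isRichWord_of_forall_tails (by decide +kernel)

theorem isSquareFreeWord_longWord : IsSquareFreeWord longWord :=
  isSquareFreeWord_of_forall_tails (by decide +kernel)

/-! ### Inserting one word into another -/

section Insertion

variable {α β : Type*}

theorem palFactors_map {f : α → β} (hf : f.Injective) (w : List α) :
    palFactors (w.map f) = List.map f '' palFactors w := by
  ext p
  constructor
  · rintro ⟨hp, hpal⟩
    obtain ⟨q, hq, rfl⟩ := List.infix_map_iff.1 hp
    refine ⟨q, ⟨hq, ?_⟩, rfl⟩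
    rw [← List.map_reverse] at hpal
    exact (List.map_injective_iff.2 hf) hpal
  · rintro ⟨q, ⟨hq, hpal⟩, rfl⟩
    exact ⟨hq.map f, by rw [← List.map_reverse, ← hpal]⟩

theorem IsRichWord.map {f : α → β} (hf : f.Injective) {w : List α} (h : IsRichWord w) :
    IsRichWord (w.map f) := by
  rw [IsRichWord, palFactors_map hf, Set.ncard_image_of_injective _ (List.map_injective_iff.2 hf),
    List.length_map]
  exact h

theorem IsSquareFreeWord.map {f : α → β} (hf : f.Injective) {w : List α}
    (h : IsSquareFreeWord w) : IsSquareFreeWord (w.map f) := by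
  intro u hu huu
  obtain ⟨q, hq, hqu⟩ := List.infix_map_iff.1 huu
  obtain ⟨a, b, rfl, rfl, hb⟩ := List.map_eq_append_iff.1 hqu.symm
  obtain rfl : b = a := (List.map_injective_iff.2 hf) hb
  exact h b (by simpa using hu) hq

/-- The word `v w₁ v~ w₂ v w₃ ⋯`: copies of `v` and of its reversal alternate, separated by the
letters of `w = w₁ w₂ w₃ ⋯`. -/
def insertWord (v : List α) : List α → List α
  | [] => v
  | c :: w => v ++ c :: insertWord v.reverse w

theorem insertWord_cons (v w : List α) (c : α) :
    insertWord v (c :: w) = v ++ c :: insertWord v.reverse w :=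
  rfl

theorem length_insertWord (v w : List α) :
    (insertWord v w).length = v.length * (w.length + 1) + w.length := by
  induction w generalizing v with
  | nil => simp [insertWord]
  | cons c w ih =>
    simp only [insertWord, List.length_append, List.length_cons, ih, List.length_reverse]
    ring

theorem insertWord_append_cons (v a b : List α) (c : α) :
    insertWord v (a ++ c :: b) =
      insertWord v a ++ c :: insertWord (List.reverse^[a.length + 1] v) b := by
  induction a generalizing v with
  | nil => rfl
  | cons d a ih => simp [insertWord, ih]

theorem reverse_insertWord (v w : List α) :
    (insertWord v w).reverse = insertWord (List.reverse^[w.length + 1] v) w.reverse := by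
  induction w generalizing v with
  | nil => rfl
  | cons c w ih =>
    have h : List.reverse^[w.length + 1] (List.reverse^[w.length + 1] v.reverse) = v.reverse := by
      rw [← Function.iterate_add_apply]
      exact congrFun (List.reverse_involutive.iterate_even ⟨w.length + 1, rfl⟩) v.reverse
    rw [insertWord_cons, List.reverse_append, List.reverse_cons, List.reverse_cons, ih,
      insertWord_append_cons, List.length_reverse, List.length_cons,
      Function.iterate_succ_apply List.reverse (w.length + 1) v, h]
    simp [insertWord]

theorem reverse_insertWord_of_odd (v : List α) {w : List α} (hw : w = w.reverse)
    (hodd : Odd w.length) : (insertWord v w).reverse = insertWord v w := by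
  rw [reverse_insertWord, List.reverse_involutive.iterate_even hodd.add_one, ← hw]
  rfl

theorem insertWord_prefix (v : List α) {w w' : List α} (h : w <+: w') :
    insertWord v w <+: insertWord v w' := by
  obtain ⟨t, rfl⟩ := h
  cases t with
  | nil => simp
  | cons c t => exact ⟨_, (insertWord_append_cons v w t c).symm⟩

theorem insertWord_suffix (v a w : List α) :
    ∃ u, (u = v ∨ u = v.reverse) ∧ insertWord u w <:+ insertWord v (a ++ w) := by
  induction a generalizing v with
  | nil => exact ⟨v, Or.inl rfl, by simp⟩
  | cons c a ih =>
    obtain ⟨u, hu, h⟩ := ih v.reverse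
    rw [List.reverse_reverse] at hu
    exact ⟨u, hu.symm, h.trans ⟨v ++ [c], by simp [insertWord]⟩⟩

theorem insertWord_infix (v : List α) {p w : List α} (h : p <:+: w) :
    ∃ u, (u = v ∨ u = v.reverse) ∧ insertWord u p <:+: insertWord v w := by
  obtain ⟨a, b, rfl⟩ := h
  obtain ⟨u, hu, h⟩ := insertWord_suffix v a p
  exact ⟨u, hu, h.isInfix.trans (insertWord_prefix v (List.prefix_append _ b)).isInfix⟩

/-- Here and below, the predicate `P` tells the letters of `w` from those of `v`. -/
theorem filter_insertWord (P : α → Bool) {v w : List α} (hv : ∀ c ∈ v, P c = false)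
    (hw : ∀ c ∈ w, P c = true) : (insertWord v w).filter P = w := by
  have hv' : ∀ v : List α, (∀ c ∈ v, P c = false) → v.filter P = [] := fun v h => by
    rw [List.filter_eq_nil_iff]
    intro c hc
    simp [h c hc]
  induction w generalizing v with
  | nil => exact hv' v hv
  | cons d w ih =>
    rw [insertWord, List.filter_append, hv' v hv, List.filter_cons_of_pos (hw d (by simp)),
      ih (by simpa using hv) fun c hc => hw c (by simp [hc])]
    rfl

theorem List.infix_or_infix_of_infix_append_cons {l a b : List α} {c : α}
    (h : l <:+: a ++ c :: b) (hc : c ∉ l) : l <:+: a ∨ l <:+: b := by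
  obtain ⟨s, t, hst⟩ := h
  rw [List.append_assoc] at hst
  rcases List.append_eq_append_iff.1 hst with ⟨s', rfl, h⟩ | ⟨s', rfl, h⟩
  · rcases List.append_eq_append_iff.1 h with ⟨s₂, rfl, h2⟩ | ⟨s₂, rfl, h2⟩
    · exact Or.inl ⟨s, s₂, by simp⟩
    · cases s₂ with
      | nil => exact Or.inl ⟨s, [], by simp⟩
      | cons d s₂ =>
        obtain ⟨rfl, -⟩ := List.cons.inj h2
        simp at hc
  · cases s' with
    | nil =>
      cases l with
      | nil => exact Or.inl List.nil_infix
      | cons d l =>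
        obtain ⟨rfl, -⟩ := List.cons.inj h
        simp at hc
    | cons d s' =>
      obtain ⟨rfl, rfl⟩ := List.cons.inj h
      exact Or.inr ⟨s', t, by simp⟩

theorem infix_of_infix_insertWord (P : α → Bool) {l v w : List α} (hl : ∀ c ∈ l, P c = false)
    (hw : ∀ c ∈ w, P c = true) (h : l <:+: insertWord v w) : l <:+: v ∨ l <:+: v.reverse := by
  induction w generalizing v with
  | nil => exact Or.inl h
  | cons d w ih =>
    have hd : d ∉ l := fun hdl => by
      have := hw d (by simp)
      rw [hl d hdl] at this
      exact Bool.false_ne_true this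
    rcases List.infix_or_infix_of_infix_append_cons h hd with h | h
    · exact Or.inl h
    · have := ih (fun c hc => hw c (by simp [hc])) h
      rw [List.reverse_reverse] at this
      exact this.symm

/-- A square in `insertWord v w` that meets letters of `w` projects to a square in `w`; any other
lies in a single copy of `v` or of its reversal. -/
theorem IsSquareFreeWord.insertWord (P : α → Bool) {v w : List α} (hv : ∀ c ∈ v, P c = false)
    (hw : ∀ c ∈ w, P c = true) (sv : IsSquareFreeWord v) (sw : IsSquareFreeWord w) :
    IsSquareFreeWord (insertWord v w) := by
  intro u hu h
  have h1 := h.filter P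
  rw [filter_insertWord P hv hw, List.filter_append] at h1
  by_cases hne : u.filter P = []
  · have hP : ∀ c ∈ u ++ u, P c = false := by
      intro c hc
      rw [List.filter_eq_nil_iff] at hne
      simpa using hne c (by simpa using hc)
    rcases infix_of_infix_insertWord P hP hw h with h2 | h2
    · exact sv u hu h2
    · exact sv.reverse u hu h2
  · exact sw _ hne h1

theorem IsSquareFreeWord.odd_length_of_palindrome {p : List α} (hs : IsSquareFreeWord p)
    (hne : p ≠ []) (hp : p = p.reverse) : Odd p.length := by
  rw [← Nat.not_even_iff_odd]
  rintro ⟨k, hk⟩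
  obtain ⟨a, b, rfl, ha⟩ : ∃ a b, p = a ++ b ∧ a.length = k :=
    ⟨p.take k, p.drop k, by simp, by simp; omega⟩
  rw [List.length_append] at hk
  rw [List.reverse_append] at hp
  obtain ⟨-, rfl⟩ := List.append_inj hp (by simp; omega)
  rcases List.eq_nil_or_concat a with rfl | ⟨a', c, rfl⟩
  · simp at hne
  · exact hs [c] (by simp) ⟨a', a'.reverse, by simp⟩

theorem List.exists_core_of_palindrome {x : List α} (hx : x.reverse = x) {k : ℕ}
    (hk : 2 * k ≤ x.length) :
    ∃ a y, a.length = k ∧ x = a ++ (y ++ a.reverse) ∧ y = y.reverse := by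
  obtain ⟨a, b, rfl, ha⟩ : ∃ a b, x = a ++ b ∧ a.length = k :=
    ⟨x.take k, x.drop k, by simp, by simp; omega⟩
  rw [List.length_append] at hk
  obtain ⟨y, c, rfl, hc⟩ : ∃ y c, b = y ++ c ∧ c.length = k :=
    ⟨b.take (b.length - k), b.drop (b.length - k), by simp, by simp; omega⟩
  rw [List.reverse_append, List.reverse_append, List.append_assoc] at hx
  obtain ⟨h1, h2⟩ := List.append_inj hx (by simp; omega)
  obtain ⟨h3, -⟩ := List.append_inj h2 (by simp)
  exact ⟨a, y, ha, by rw [← h1, List.reverse_reverse], h3.symm⟩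

/-- A nonempty palindromic factor `p` of `w` has odd length, so `insertWord u p` is a palindrome
for `u = v` or `u = v.reverse`; it stays one when `k ≤ |v|` letters are removed on both sides. -/
theorem exists_mem_palFactors_insertWord (P : α → Bool) {v w p : List α}
    (hv : ∀ c ∈ v, P c = false) (hw : ∀ c ∈ w, P c = true) (sw : IsSquareFreeWord w)
    (hp : p ∈ palFactors w) (hne : p ≠ []) {k : ℕ} (hk : k ≤ v.length) :
    ∃ q ∈ palFactors (insertWord v w), q.filter P = p ∧
      q.length + 2 * k = v.length * (p.length + 1) + p.length := by
  obtain ⟨hpw, hpal⟩ := hp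
  have hodd := (sw.infix hpw).odd_length_of_palindrome hne hpal
  obtain ⟨u, hu, hui⟩ := insertWord_infix v hpw
  have hul : u.length = v.length := by rcases hu with rfl | rfl <;> simp
  have huP : ∀ c ∈ u, P c = false := by rcases hu with rfl | rfl <;> simpa using hv
  have hlen := length_insertWord u p
  rw [hul] at hlen
  have hpos : 1 ≤ p.length := List.length_pos_of_ne_nil hne
  obtain ⟨a, q, rfl, haq, hq⟩ :=
    List.exists_core_of_palindrome (reverse_insertWord_of_odd u hpal hodd) (k := k)
      (by rw [hlen]; nlinarith)
  have hau : a <+: u :=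
    List.prefix_of_prefix_length_le (l₃ := insertWord u p) (haq ▸ List.prefix_append _ _)
      (insertWord_prefix u (w := []) List.nil_prefix) (by omega)
  have ha : a.filter P = [] := by
    rw [List.filter_eq_nil_iff]
    intro c hc
    simp [huP c (hau.subset hc)]
  refine ⟨q, ⟨List.IsInfix.trans ⟨a, a.reverse, by rw [haq]; simp⟩ hui, hq⟩, ?_, ?_⟩
  · have h1 := filter_insertWord P huP fun c hc => hw c (hpw.subset hc)
    rw [haq, List.filter_append, List.filter_append, List.filter_reverse, ha] at h1
    simpa using h1
  · rw [← hlen, haq]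
    simp
    omega

/-- The palindromes extending those of `w`, together with those of `v`, are as many as a word of
this length can have. -/
theorem IsRichWord.insertWord (P : α → Bool) {v w : List α} (hv : ∀ c ∈ v, P c = false)
    (hw : ∀ c ∈ w, P c = true) (sw : IsSquareFreeWord w) (rv : IsRichWord v)
    (rw' : IsRichWord w) : IsRichWord (insertWord v w) := by
  refine IsRichWord.of_le ?_
  set S : Set (List α × ℕ) := (palFactors w \ {[]}) ×ˢ (Set.Iic v.length) with hS
  have hex : ∀ x : List α × ℕ, ∃ q, x ∈ S → q ∈ palFactors (_root_.insertWord v w) ∧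
      q.filter P = x.1 ∧ q.length + 2 * x.2 = v.length * (x.1.length + 1) + x.1.length := by
    rintro ⟨p, k⟩
    by_cases hx : (p, k) ∈ S
    · obtain ⟨q, hq⟩ := exists_mem_palFactors_insertWord P hv hw sw hx.1.1 hx.1.2 hx.2
      exact ⟨q, fun _ => hq⟩
    · exact ⟨[], fun h => absurd h hx⟩
  choose g hg using hex
  have hinj : Set.InjOn g S := by
    rintro ⟨p, k⟩ hx ⟨p', k'⟩ hx' h
    obtain ⟨-, h1, h2⟩ := hg _ hx
    obtain ⟨-, h1', h2'⟩ := hg _ hx'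
    rw [h, h1'] at h1
    obtain rfl : p' = p := h1
    rw [h] at h2
    obtain rfl : k = k' := by simp only at h2 h2'; omega
    rfl
  have hfin : (g '' S).Finite :=
    (((palFactors_finite w).sdiff).prod (Set.finite_Iic _)).image g
  have hdisj : Disjoint (g '' S) (palFactors v) := by
    rw [Set.disjoint_left]
    rintro _ ⟨x, hx, rfl⟩ ⟨hi, -⟩
    refine hx.1.2 ?_
    rw [Set.mem_singleton_iff, ← (hg x hx).2.1, List.filter_eq_nil_iff]
    intro c hc
    simp [hv c (hi.subset hc)]
  have hsub : g '' S ∪ palFactors v ⊆ palFactors (_root_.insertWord v w) := by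
    rintro q (⟨x, hx, rfl⟩ | ⟨hq, hpal⟩)
    · exact (hg x hx).1
    · exact ⟨hq.trans (insertWord_prefix v (w := []) List.nil_prefix).isInfix, hpal⟩
  have hcard := Set.ncard_le_ncard hsub (palFactors_finite _)
  have h0 : (palFactors w \ {[]}).ncard = w.length := by
    rw [Set.ncard_sdiff_singleton_of_mem (nil_mem_palFactors w), rw', Nat.add_sub_cancel]
  have h1 : (Set.Iic v.length).ncard = v.length + 1 := by
    rw [Set.ncard_eq_toFinset_card', Set.toFinset_Iic, Nat.card_Iic]
  rw [Set.ncard_union_eq hdisj hfin (palFactors_finite v), hinj.ncard_image, hS, Set.ncard_prod,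
    h0, h1, rv] at hcard
  rw [length_insertWord]
  linarith

end Insertion

/-! ### The lower bound and the conclusion -/

/-- Multiplicativity of the lower bound: over disjoint alphabets, the lengths increased by one
multiply. -/
theorem exists_mem_richSquareFreeLengths_add {m k l l' : ℕ} (h : l ∈ richSquareFreeLengths m)
    (h' : l' ∈ richSquareFreeLengths k) :
    ∃ j ∈ richSquareFreeLengths (m + k), j + 1 = (l + 1) * (l' + 1) := by
  obtain ⟨v, rv, sv, rfl⟩ := h
  obtain ⟨w, rw', sw, rfl⟩ := h'
  have hi := Fin.castAdd_injective m k
  have hi' := Fin.natAdd_injective k m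
  let P : Fin (m + k) → Bool := fun c => decide (m ≤ c)
  have hv : ∀ c ∈ v.map (Fin.castAdd k), P c = false := by
    intro c hc
    obtain ⟨d, -, rfl⟩ := List.mem_map.1 hc
    simp [P]
  have hw : ∀ c ∈ w.map (Fin.natAdd m), P c = true := by
    intro c hc
    obtain ⟨d, -, rfl⟩ := List.mem_map.1 hc
    simp [P]
  refine ⟨_, ⟨insertWord (v.map (Fin.castAdd k)) (w.map (Fin.natAdd m)),
    IsRichWord.insertWord P hv hw (sw.map hi') (rv.map hi) (rw'.map hi'),
    IsSquareFreeWord.insertWord P hv hw (sv.map hi) (sw.map hi'), rfl⟩, ?_⟩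
  rw [length_insertWord, List.length_map, List.length_map]
  ring

theorem one_mem_richSquareFreeLengths : 1 ∈ richSquareFreeLengths 1 :=
  ⟨[0], isRichWord_of_forall_tails (by decide), isSquareFreeWord_of_forall_tails (by decide), rfl⟩

theorem exists_mem_richSquareFreeLengths_gt (n : ℕ) (hn : 5 ≤ n) :
    ∃ l ∈ richSquareFreeLengths n, (2.008 : ℝ) ^ n < l := by
  have h5 : 33 ∈ richSquareFreeLengths 5 :=
    ⟨longWord, isRichWord_longWord, isSquareFreeWord_longWord, rfl⟩
  have hbase : ∀ j, ∃ l ∈ richSquareFreeLengths (5 + j), l + 1 = 34 * 2 ^ j := by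
    intro j
    induction j with
    | zero => exact ⟨33, h5, rfl⟩
    | succ j ih =>
      obtain ⟨l, hl, hl1⟩ := ih
      obtain ⟨l', hl', h⟩ :=
        exists_mem_richSquareFreeLengths_add hl one_mem_richSquareFreeLengths
      exact ⟨l', hl', by rw [h, hl1, pow_succ, mul_assoc]⟩
  induction n using Nat.strong_induction_on with
  | _ n ih =>
  rcases Nat.lt_or_ge n 10 with hlt | hge
  · obtain ⟨j, rfl⟩ := Nat.exists_eq_add_of_le hn
    obtain ⟨l, hl, hl1⟩ := hbase j
    refine ⟨l, hl, ?_⟩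
    have hl2 : (l : ℝ) + 1 = 34 * 2 ^ j := by exact_mod_cast hl1
    have : (2.008 : ℝ) ^ (5 + j) < 34 * 2 ^ j - 1 := by
      have hj : j < 5 := by omega
      interval_cases j <;> norm_num
    linarith
  · obtain ⟨k, rfl⟩ := Nat.exists_eq_add_of_le' hge
    obtain ⟨l, hl, hlk⟩ := ih (k + 5) (by omega) (by omega)
    obtain ⟨l', hl', h⟩ := exists_mem_richSquareFreeLengths_add hl h5
    refine ⟨l', hl', ?_⟩
    have h2 : (l' : ℝ) + 1 = (l + 1) * 34 := by exact_mod_cast h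
    have h3 : (2.008 : ℝ) ^ (k + 10) = 2.008 ^ (k + 5) * 2.008 ^ 5 := by rw [← pow_add]
    have h4 : (2.008 : ℝ) ^ 5 < 33 := by norm_num
    have h5 : (0 : ℝ) < 2.008 ^ (k + 5) := by positivity
    nlinarith

theorem mainTheorem5 (n : ℕ) (hn : 5 ≤ n) :
    IsGreatest (richSquareFreeLengths n) (maxRichSquareFreeLength n) ∧
      (2.008 : ℝ) ^ n < (maxRichSquareFreeLength n : ℝ) ∧
      (maxRichSquareFreeLength n : ℝ) < (2.237 : ℝ) ^ n := by
  have hmax := isGreatest_maxRichSquareFreeLength n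
  refine ⟨hmax, ?_, ?_⟩
  · obtain ⟨l, hl, hlt⟩ := exists_mem_richSquareFreeLengths_gt n hn
    exact hlt.trans_le (by exact_mod_cast hmax.2 hl)
  · obtain ⟨w, hr, hs, hlen⟩ := hmax.1
    have := hr.length_add_one_le hs
    rw [hlen] at this
    linarith
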